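/- **Setting.** Let $(\mathcal A;\mathcal E)$ be an exact category: $\mathcal A$ is an additive category and $\mathcal E$ is an exact structure on it in the sense of Quillen, whose distinguished kernel-cokernel pairs $A\to B\to C$ are called conflations; the second morphism of a conflation is called a deflation. An ideal of $\mathcal A$ is an additive subbifunctor of $\mathrm{Hom}$, and $\langle\mathcal M\rangle$ denotes the smallest ideal containing a class $\mathcal M$ of morphisms. The product of two ideals is $\mathcal I\mathcal J=\langle ij \mid i\in\mathcal I,\ j\in\mathcal J \text{ composable}\rangle$. Subcategories are full. A conflation of arrows $\xi: i\to a\to j$ (with $i:I_0\to I_1$, $a:A_0\to A_1$, $j:J_0\to J_1$) is a morphism $(i,a,j)$ from a conflation $I_0\to A_0\xrightarrow{e_0} J_0$ to a conflation $I_1\xrightarrow{m_1}A_1\to J_1$. It is mono-epi (ME) if it factors as $(i,a^2,1_{J_1})\circ(1_{I_0},a^1,j)$ through some conflation $I_0\to M\to J_1$. It is null-homotopic if $a=m_1h+ge_0$ for some $h:A_0\to I_1$ and $g:J_0\to A_1$. We write $a=i\star j$ if there is an ME-conflation $i\to a\to j$, and, for objects, $Z=X\star Y$ if there is a conflation $X\to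 Z\to Y$. For subcategories, $\mathcal X\star\mathcal Y$ is the subcategory of all objects $X\star Y$ with $X\in\mathcal X$, $Y\in\mathcal Y$. For ideals, $\mathcal I\diamond\mathcal J=\langle i\star j\mid i\in\mathcal I,\ j\in\mathcal J\rangle$. Finally, $\mathcal I^\perp$ consists of the morphisms $k$ such that, for every $i\in\mathcal I$, every ME-conflation $k\to a\to i$ is null-homotopic. A special $\mathcal I$-precover of an object $A$, with $\mathcal I$-syzygy $k$, is a morphism $i_1:C_1\to A$ in $\mathcal I$ that is the deflation of the lower row of a conflation of arrows $k\to c\to 1_A$ with $k\in\mathcal I^\perp$. It is object-special if $k$ can be chosen to be an isomorphism; the kernel of $i_1$ is then called an object $\mathcal I$-syzygy of $A$. The ideal $\mathcal I$ is (object-)special precovering if every object of $\mathcal A$ has an (object-)special $\mathcal I$-precover. An $\mathcal I$-syzygy ideal is an ideal contained in $\mathcal I^\perp$ that contains an $\mathcal I$-syzygy of every object. An $\mathcal I$-syzygy subcategory is a subcategory $\mathcal C$ closed under finite direct sums such that the ideal $\langle 1_X\mid X\in\mathcal C\rangle$ is an $\mathcal I$-syzygy ideal. **Theorem.** Let $\mathcal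 I$ and $\mathcal J$ be ideals of $\mathcal A$. 1. (The Chain Rule) If $i:C\to A$ is a special $\mathcal I$-precover with $\mathcal I$-syzygy $\omega_{\mathcal I}$ and $j:D\to C$ is a special $\mathcal J$-precover with $\mathcal J$-syzygy $\omega_{\mathcal J}$, then $ij:D\to A$ is a special $\mathcal I\mathcal J$-precover of $A$ with an $\mathcal I\mathcal J$-syzygy of the form $\omega_{\mathcal J}\star\omega_{\mathcal I}$. 2. If moreover $i$ and $j$ are object-special, with kernels $\Omega_{\mathcal I}$ and $\Omega_{\mathcal J}$ respectively, then $ij$ is an object-special $\mathcal I\mathcal J$-precover of $A$ whose kernel is of the form $\Omega_{\mathcal J}\star\Omega_{\mathcal I}$. 3. If $\mathcal I$ and $\mathcal J$ are special precovering ideals, then so is $\mathcal I\mathcal J$; and if $\omega(\mathcal I)$ is an $\mathcal I$-syzygy ideal and $\omega(\mathcal J)$ a $\mathcal J$-syzygy ideal, then $\omega(\mathcal J)\diamond\omega(\mathcal I)$ is an $\mathcal I\mathcal J$-syzygy ideal. 4. If $\mathcal I$ and $\mathcal J$ are object-special precovering ideals, then so is $\mathcal I\mathcal J$; and if $\Omega(\mathcal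 I)$ is an $\mathcal I$-syzygy subcategory and $\Omega(\mathcal J)$ a $\mathcal J$-syzygy subcategory, then $\Omega(\mathcal J)\star\Omega(\mathcal I)$ is an $\mathcal I\mathcal J$-syzygy subcategory. -/

import Mathlib

open CategoryTheory CategoryTheory.Limits

universe v u

namespace IdealApprox

section Ideals

variable {A : Type u} [Category.{v} A] [Preadditive A]

/-- An ideal of a preadditive category: an additive subbifunctor of `Hom`. -/
structure MorIdeal (A : Type u) [Category.{v} A] [Preadditive A] where
  /-- the subgroup `I (X, Y)` of `Hom (X, Y)` -/
  hom (X Y : A) : AddSubgroup (X ⟶ Y)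
  comp_mem {W X Y Z : A} (h : W ⟶ X) (g : X ⟶ Y) (f : Y ⟶ Z) :
    g ∈ hom X Y → h ≫ g ≫ f ∈ hom W Z

/-- The class of morphisms belonging to an ideal. -/
def MorIdeal.mor (I : MorIdeal A) : MorphismProperty A := fun X Y f => f ∈ I.hom X Y

/-- The smallest ideal `⟨M⟩` containing a class `M` of morphisms. -/
def MorIdeal.span (M : MorphismProperty A) : MorIdeal A where
  hom X Y := ⨅ I : {I : MorIdeal A // M ≤ I.mor}, I.1.hom X Y
  comp_mem h g f hg := by
    rw [AddSubgroup.mem_iInf] at hg ⊢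
    exact fun I => I.1.comp_mem h g f (hg I)

/-- The class of composites `i ∘ j` with `i ∈ I` and `j ∈ J`. -/
def MorIdeal.composites (I J : MorIdeal A) : MorphismProperty A := fun X Z f =>
  ∃ (Y : A) (j : X ⟶ Y) (i : Y ⟶ Z), J.mor j ∧ I.mor i ∧ j ≫ i = f

/-- The product ideal `IJ`, generated by the composites `i ∘ j`, `i ∈ I`, `j ∈ J`. -/
def MorIdeal.prod (I J : MorIdeal A) : MorIdeal A := MorIdeal.span (I.composites J)

/-- The class of identity morphisms of the objects of a (full) subcategory. -/
def identities (P : ObjectProperty A) : MorphismProperty A := fun X Y f =>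
  P X ∧ ∃ h : X = Y, f = eqToHom h

/-- The object ideal generated by a (full) subcategory. -/
def objIdeal (P : ObjectProperty A) : MorIdeal A := MorIdeal.span (identities P)

end Ideals

/-- `X ⟶ Y ⟶ Z` is a kernel-cokernel pair. -/
def IsKernelCokernelPair {A : Type u} [Category.{v} A] [Preadditive A] {X Y Z : A}
    (m : X ⟶ Y) (e : Y ⟶ Z) : Prop :=
  ∃ w : m ≫ e = 0, Nonempty (IsLimit (KernelFork.ofι m w)) ∧
    Nonempty (IsColimit (CokernelCofork.ofπ e w))

/-- An exact structure (in the sense of Quillen) on an additive category. -/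
structure ExactStr (A : Type u) [Category.{v} A] [Preadditive A] where
  /-- the distinguished kernel-cokernel pairs -/
  conf {X Y Z : A} (m : X ⟶ Y) (e : Y ⟶ Z) : Prop
  pair {X Y Z : A} {m : X ⟶ Y} {e : Y ⟶ Z} : conf m e → IsKernelCokernelPair m e
  of_iso {X Y Z X' Y' Z' : A} {m : X ⟶ Y} {e : Y ⟶ Z} {m' : X' ⟶ Y'} {e' : Y' ⟶ Z'}
    (α : X ≅ X') (β : Y ≅ Y') (γ : Z ≅ Z') :
    m ≫ β.hom = α.hom ≫ m' → e ≫ γ.hom = β.hom ≫ e' → conf m e → conf m' e'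
  id_inflation (X : A) : ∃ (Z : A) (e : X ⟶ Z), conf (𝟙 X) e
  id_deflation (X : A) : ∃ (K : A) (m : K ⟶ X), conf m (𝟙 X)
  inflation_comp {X Y Z C D : A} {m : X ⟶ Y} {n : Y ⟶ Z} {e : Y ⟶ C} {f : Z ⟶ D} :
    conf m e → conf n f → ∃ (B : A) (g : Z ⟶ B), conf (m ≫ n) g
  deflation_comp {X Y Z K L : A} {e : X ⟶ Y} {f : Y ⟶ Z} {m : K ⟶ X} {n : L ⟶ Y} :
    conf m e → conf n f → ∃ (M : A) (g : M ⟶ X), conf g (e ≫ f)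
  pushout_inflation {X Y Z X' : A} {m : X ⟶ Y} {e : Y ⟶ Z} (f : X ⟶ X') : conf m e →
    ∃ (Y' : A) (m' : X' ⟶ Y') (f' : Y ⟶ Y'), IsPushout m f f' m' ∧
      ∃ (Z' : A) (e' : Y' ⟶ Z'), conf m' e'
  pullback_deflation {X Y Z Z' : A} {m : X ⟶ Y} {e : Y ⟶ Z} (f : Z' ⟶ Z) : conf m e →
    ∃ (Y' : A) (e' : Y' ⟶ Z') (f' : Y' ⟶ Y), IsPullback f' e' e f ∧
      ∃ (X' : A) (m' : X' ⟶ Y'), conf m' e'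

section Exact

variable {A : Type u} [Category.{v} A] [Preadditive A] (E : ExactStr A)

/-- A conflation `i ⟶ a ⟶ j` of arrows for the exact structure `Arr(E)`, that is, a morphism
`(i, a, j)` from a conflation `I₀ ⟶ A₀ ⟶ J₀` to a conflation `I₁ ⟶ A₁ ⟶ J₁`. -/
structure ArrConf {I₀ I₁ A₀ A₁ J₀ J₁ : A} (i : I₀ ⟶ I₁) (a : A₀ ⟶ A₁) (j : J₀ ⟶ J₁) where
  m₀ : I₀ ⟶ A₀
  e₀ : A₀ ⟶ J₀
  m₁ : I₁ ⟶ A₁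
  e₁ : A₁ ⟶ J₁
  conf₀ : E.conf m₀ e₀
  conf₁ : E.conf m₁ e₁
  comm_m : m₀ ≫ a = i ≫ m₁
  comm_e : e₀ ≫ j = a ≫ e₁

variable {E}

/-- The conflation `i ⟶ a ⟶ j` of arrows is mono-epi (ME): it factors, as a morphism of
conflations, through a conflation `I₀ ⟶ M ⟶ J₁` by morphisms of the form
`(1, a¹, j)` and `(i, a², 1)`. -/
def ArrConf.IsME {I₀ I₁ A₀ A₁ J₀ J₁ : A} {i : I₀ ⟶ I₁} {a : A₀ ⟶ A₁} {j : J₀ ⟶ J₁}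
    (ξ : ArrConf E i a j) : Prop :=
  ∃ (M : A) (m : I₀ ⟶ M) (e : M ⟶ J₁) (a1 : A₀ ⟶ M) (a2 : M ⟶ A₁),
    E.conf m e ∧ a1 ≫ a2 = a ∧
    ξ.m₀ ≫ a1 = m ∧ ξ.e₀ ≫ j = a1 ≫ e ∧
    m ≫ a2 = i ≫ ξ.m₁ ∧ e = a2 ≫ ξ.e₁

/-- The conflation of arrows is null-homotopic. -/
def ArrConf.IsNullHomotopic {I₀ I₁ A₀ A₁ J₀ J₁ : A} {i : I₀ ⟶ I₁} {a : A₀ ⟶ A₁}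
    {j : J₀ ⟶ J₁} (ξ : ArrConf E i a j) : Prop :=
  ∃ (h : A₀ ⟶ I₁) (g : J₀ ⟶ A₁), a = h ≫ ξ.m₁ + ξ.e₀ ≫ g

variable (E)

/-- `a = i ⋆ j`: the arrow `a` is an extension of `j` by `i`, i.e. there is an ME-conflation
`i ⟶ a ⟶ j`. -/
def IsStar {I₀ I₁ A₀ A₁ J₀ J₁ : A} (i : I₀ ⟶ I₁) (a : A₀ ⟶ A₁) (j : J₀ ⟶ J₁) : Prop :=
  ∃ ξ : ArrConf E i a j, ξ.IsME

/-- `Z = X ⋆ Y` for objects: there is a conflation `X ⟶ Z ⟶ Y`. -/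
def IsObjStar (X Z Y : A) : Prop := ∃ (m : X ⟶ Z) (e : Z ⟶ Y), E.conf m e

/-- The class `M ⋆ N` of all extensions `i ⋆ j` with `i ∈ M` and `j ∈ N`. -/
def starMor (M N : MorphismProperty A) : MorphismProperty A := fun _ _ a =>
  ∃ (I₀ I₁ J₀ J₁ : A) (i : I₀ ⟶ I₁) (j : J₀ ⟶ J₁), M i ∧ N j ∧ IsStar E i a j

/-- The extension ideal `I ◇ J`, generated by the extensions `i ⋆ j`, `i ∈ I`, `j ∈ J`. -/
def diamond (I J : MorIdeal A) : MorIdeal A := MorIdeal.span (starMor E I.mor J.mor)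

/-- The subcategory `P ⋆ Q` of all extensions `X ⋆ Y` with `X ∈ P` and `Y ∈ Q`. -/
def starObj (P Q : ObjectProperty A) : ObjectProperty A := fun Z =>
  ∃ X Y : A, P X ∧ Q Y ∧ IsObjStar E X Z Y

/-- `Ext (j, i) = 0`: every ME-conflation `i ⟶ a ⟶ j` is null-homotopic. -/
def ExtOrth {J₀ J₁ I₀ I₁ : A} (j : J₀ ⟶ J₁) (i : I₀ ⟶ I₁) : Prop :=
  ∀ (A₀ A₁ : A) (a : A₀ ⟶ A₁) (ξ : ArrConf E i a j), ξ.IsME → ξ.IsNullHomotopic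

/-- The morphisms `k` of the right perpendicular `I^⊥`: `Ext (i, k) = 0` for all `i ∈ I`. -/
def rightPerp (I : MorIdeal A) : MorphismProperty A := fun _ _ k =>
  ∀ (X Y : A) (i : X ⟶ Y), I.mor i → ExtOrth E i k

/-- `i₁ : C₁ ⟶ X` is a special `I`-precover of `X` with `I`-syzygy `k`: the morphism `i₁` lies
in `I`, the morphism `k` lies in `I^⊥`, and `i₁` is the deflation of the lower row of a conflation
of arrows `k ⟶ c ⟶ 1_X` (the left hand square of which is then a pushout). -/
def IsSpecialPrecoverWith (I : MorIdeal A) {C₁ X : A} (i₁ : C₁ ⟶ X) {K₀ K₁ : A}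
    (k : K₀ ⟶ K₁) : Prop :=
  I.mor i₁ ∧ rightPerp E I k ∧
    ∃ (C₀ : A) (c : C₀ ⟶ C₁) (ξ : ArrConf E k c (𝟙 X)), ξ.e₁ = i₁

/-- `i₁` is a special `I`-precover. -/
def IsSpecialPrecover (I : MorIdeal A) {C₁ X : A} (i₁ : C₁ ⟶ X) : Prop :=
  ∃ (K₀ K₁ : A) (k : K₀ ⟶ K₁), IsSpecialPrecoverWith E I i₁ k

/-- `i₁` is an object-special `I`-precover: it has an `I`-syzygy that is an isomorphism. -/
def IsObjSpecialPrecover (I : MorIdeal A) {C₁ X : A} (i₁ : C₁ ⟶ X) : Prop :=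
  ∃ (K₀ K₁ : A) (k : K₀ ⟶ K₁), IsIso k ∧ IsSpecialPrecoverWith E I i₁ k

/-- `i₁` is an object-special `I`-precover with kernel (object `I`-syzygy) `Ω`. -/
def IsObjSpecialPrecoverWith (I : MorIdeal A) {C₁ X : A} (i₁ : C₁ ⟶ X) (Ω : A) : Prop :=
  IsObjSpecialPrecover E I i₁ ∧ ∃ m : Ω ⟶ C₁, E.conf m i₁

/-- Every object has a special `I`-precover. -/
def IsSpecialPrecovering (I : MorIdeal A) : Prop :=
  ∀ X : A, ∃ (C : A) (i : C ⟶ X), IsSpecialPrecover E I i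

/-- Every object has an object-special `I`-precover. -/
def IsObjSpecialPrecovering (I : MorIdeal A) : Prop :=
  ∀ X : A, ∃ (C : A) (i : C ⟶ X), IsObjSpecialPrecover E I i

/-- `W` is an `I`-syzygy ideal: it is contained in `I^⊥` and contains an `I`-syzygy of every
object. -/
def IsSyzygyIdeal (I W : MorIdeal A) : Prop :=
  W.mor ≤ rightPerp E I ∧
    ∀ X : A, ∃ (C : A) (i : C ⟶ X) (K₀ K₁ : A) (k : K₀ ⟶ K₁),
      IsSpecialPrecoverWith E I i k ∧ W.mor k

/-- `P` is an `I`-syzygy subcategory: it is closed under finite direct sums (which are the finite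
products of an additive category) and the ideal it generates is an `I`-syzygy ideal. -/
def IsSyzygySubcat (I : MorIdeal A) (P : ObjectProperty A) : Prop :=
  P.IsClosedUnderFiniteProducts ∧ IsSyzygyIdeal E I (objIdeal P)

end Exact

end IdealApprox

/-! `Ext (f, w) = 0` says that pulling an extension of `J₁` by `I₀` back along `f` and pushing it
out along `w` always splits it. Equivalently, `f` lifts through the deflation of the pushout along
`w`, or `w` extends along the inflation of the pullback along `f`. Lifts can be added in `f` and
extensions in `w`, so both perpendiculars are ideals.

The core is `ExtOrth.comp_of_isStar`: if `w = l ⋆ k`, then `i` is lifted past the quotient part `k`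
of `w`, and the remaining obstruction, an extension by the source of `l`, is removed by `j`. Since
the left perpendicular of `w` is an ideal, testing the composites `ij` suffices for the whole
product ideal (`rightPerp_prod_of_isStar`).

The kernel of a composite deflation `ij` is an extension of the kernel of `i` by that of `j`. Doing
this in both rows yields a syzygy `l ⋆ k` (`IsSpecialPrecoverWith.comp`). For subcategories, a
syzygy that factors through an object of the subcategory can be replaced by that object. -/

namespace IdealApprox

/-! ### Conflations under pushout, pullback and composition. -/

section Conflations

variable {A : Type u} [Category.{v} A] [Preadditive A] {E : ExactStr A}

namespace ExactStr

variable {X Y Z : A} {m : X ⟶ Y} {e : Y ⟶ Z}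

lemma conf.w (h : E.conf m e) : m ≫ e = 0 := (E.pair h).1

lemma conf.lift (h : E.conf m e) {T : A} (f : T ⟶ Y) (hf : f ≫ e = 0) : ∃ g, g ≫ m = f := by
  obtain ⟨w, ⟨hl⟩, -⟩ := E.pair h
  obtain ⟨g, hg⟩ := KernelFork.IsLimit.lift' hl f hf
  exact ⟨g, hg⟩

lemma conf.desc (h : E.conf m e) {T : A} (f : Y ⟶ T) (hf : m ≫ f = 0) : ∃ g, e ≫ g = f := by
  obtain ⟨w, -, ⟨hc⟩⟩ := E.pair h
  obtain ⟨g, hg⟩ := CokernelCofork.IsColimit.desc' hc f hf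
  exact ⟨g, hg⟩

lemma conf.mono (h : E.conf m e) : Mono m := by
  obtain ⟨w, ⟨hl⟩, -⟩ := E.pair h
  exact Fork.IsLimit.mono hl

lemma conf.epi (h : E.conf m e) : Epi e := by
  obtain ⟨w, -, ⟨hc⟩⟩ := E.pair h
  exact Cofork.IsColimit.epi hc

/-- A cokernel of an inflation completes it to a conflation. -/
lemma conf.of_cokernel (h : E.conf m e) {Z' : A} (e' : Y ⟶ Z') [Epi e'] (w : m ≫ e' = 0)
    (hd : ∀ {T : A} (f : Y ⟶ T), m ≫ f = 0 → ∃ g, e' ≫ g = f) : E.conf m e' := by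
  obtain ⟨p, hp⟩ := h.desc e' w
  obtain ⟨q, hq⟩ := hd e h.w
  have := h.epi
  refine E.of_iso (Iso.refl _) (Iso.refl _) ⟨p, q, ?_, ?_⟩ (by simp) (by simpa using hp) h
  · rw [← cancel_epi e, reassoc_of% hp, hq, Category.comp_id]
  · rw [← cancel_epi e', reassoc_of% hq, hp, Category.comp_id]

/-- A kernel of a deflation completes it to a conflation. -/
lemma conf.of_kernel (h : E.conf m e) {X' : A} (m' : X' ⟶ Y) [Mono m'] (w : m' ≫ e = 0)
    (hl : ∀ {T : A} (f : T ⟶ Y), f ≫ e = 0 → ∃ g, g ≫ m' = f) : E.conf m' e := by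
  obtain ⟨p, hp⟩ := h.lift m' w
  obtain ⟨q, hq⟩ := hl m h.w
  have := h.mono
  refine E.of_iso ⟨q, p, ?_, ?_⟩ (Iso.refl _) (Iso.refl _) (by simpa using hq.symm) (by simp) h
  · rw [← cancel_mono m, Category.assoc, hp, hq, Category.id_comp]
  · rw [← cancel_mono m', Category.assoc, hq, hp, Category.id_comp]

/-- Any pushout of an inflation is an inflation with the same cokernel. -/
lemma conf.of_isPushout (h : E.conf m e) {X' Y' : A} {f : X ⟶ X'} {f' : Y ⟶ Y'} {m' : X' ⟶ Y'}
    (sq : IsPushout m f f' m') {e' : Y' ⟶ Z} (he : f' ≫ e' = e) (hm : m' ≫ e' = 0) :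
    E.conf m' e' := by
  -- The axiom leaves the cokernel unspecified: uniqueness of pushouts makes `m'` an inflation, and
  -- `e'` is then shown to be its cokernel.
  obtain ⟨Y'', m'', f'', sq', Z'', e'', h''⟩ := E.pushout_inflation f h
  have hY : E.conf m' ((sq.isoIsPushout _ _ sq').hom ≫ e'') :=
    E.of_iso (Iso.refl _) (sq.isoIsPushout _ _ sq').symm (Iso.refl _) (by simp) (by simp) h''
  have := h.epi
  have : Epi e' := epi_of_epi_fac he
  refine hY.of_cokernel e' hm fun {T} g hg => ?_
  obtain ⟨t, ht⟩ := h.desc (f' ≫ g) (by rw [← Category.assoc, sq.w, Category.assoc, hg, comp_zero])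
  refine ⟨t, sq.hom_ext ?_ ?_⟩
  · rw [reassoc_of% he, ht]
  · rw [reassoc_of% hm, hg, zero_comp]

/-- Any pullback of a deflation is a deflation with the same kernel. -/
lemma conf.of_isPullback (h : E.conf m e) {Z' Y' : A} {f : Z' ⟶ Z} {f' : Y' ⟶ Y} {e' : Y' ⟶ Z'}
    (sq : IsPullback f' e' e f) {m' : X ⟶ Y'} (hm : m' ≫ f' = m) (he : m' ≫ e' = 0) :
    E.conf m' e' := by
  obtain ⟨Y'', e'', f'', sq', X'', m'', h''⟩ := E.pullback_deflation f h
  have hY : E.conf (m'' ≫ (sq.isoIsPullback _ _ sq').inv) e' :=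
    E.of_iso (Iso.refl _) (sq.isoIsPullback _ _ sq').symm (Iso.refl _) (by simp) (by simp) h''
  have := h.mono
  have : Mono m' := mono_of_mono_fac hm
  refine hY.of_kernel m' he fun {T} g hg => ?_
  obtain ⟨t, ht⟩ := h.lift (g ≫ f') (by rw [Category.assoc, sq.w, reassoc_of% hg, zero_comp])
  refine ⟨t, sq.hom_ext ?_ ?_⟩
  · rw [Category.assoc, hm, ht]
  · rw [Category.assoc, he, hg, comp_zero]

lemma conf.pushout (h : E.conf m e) {X' : A} (f : X ⟶ X') :
    ∃ (Y' : A) (m' : X' ⟶ Y') (f' : Y ⟶ Y') (e' : Y' ⟶ Z),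
      IsPushout m f f' m' ∧ E.conf m' e' ∧ f' ≫ e' = e := by
  obtain ⟨Y', m', f', sq, -⟩ := E.pushout_inflation f h
  have w : m ≫ e = f ≫ 0 := by rw [h.w, comp_zero]
  exact ⟨Y', m', f', sq.desc e 0 w, sq,
    h.of_isPushout sq (sq.inl_desc _ _ _) (sq.inr_desc _ _ _), sq.inl_desc _ _ _⟩

lemma conf.pullback (h : E.conf m e) {Z' : A} (f : Z' ⟶ Z) :
    ∃ (Y' : A) (m' : X ⟶ Y') (f' : Y' ⟶ Y) (e' : Y' ⟶ Z'),
      IsPullback f' e' e f ∧ E.conf m' e' ∧ m' ≫ f' = m := by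
  obtain ⟨Y', e', f', sq, -⟩ := E.pullback_deflation f h
  have w : m ≫ e = 0 ≫ f := by rw [h.w, zero_comp]
  exact ⟨Y', sq.lift m 0 w, f', e', sq,
    h.of_isPullback sq (sq.lift_fst _ _ _) (sq.lift_snd _ _ _), sq.lift_fst _ _ _⟩

/-- The cokernel of a composite of inflations `X ⟶ Y ⟶ Y'` is the pushout of `Y'` along the
cokernel of the first one. -/
lemma conf.comp_of_isPushout (h : E.conf m e) {Y' Z' P : A} {n : Y ⟶ Y'} {q : Y' ⟶ Z'}
    (h' : E.conf n q) {p : Y' ⟶ P} {κ : Z ⟶ P} (sq : IsPushout n e p κ) :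
    E.conf (m ≫ n) p := by
  obtain ⟨B, g, hB⟩ := E.inflation_comp h h'
  have := h.epi
  have : Epi p := ⟨fun a b hab => sq.hom_ext hab <| by
    rw [← cancel_epi e, ← Category.assoc, ← sq.w, ← Category.assoc, ← sq.w, Category.assoc,
      Category.assoc, hab]⟩
  refine hB.of_cokernel p ?_ fun {T} f hf => ?_
  · rw [Category.assoc, sq.w, reassoc_of% h.w, zero_comp]
  · obtain ⟨t, ht⟩ := h.desc (n ≫ f) (by rw [← Category.assoc, hf])
    exact ⟨sq.desc f t ht.symm, sq.inl_desc _ _ _⟩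

/-- The kernel of a composite of deflations `Y' ⟶ Y ⟶ Z` is the pullback of `Y'` along the
kernel of the second one. -/
lemma conf.comp_of_isPullback (h : E.conf m e) {X' Y' P : A} {n : X' ⟶ Y'} {q : Y' ⟶ Y}
    (h' : E.conf n q) {p : P ⟶ Y'} {κ : P ⟶ X} (sq : IsPullback p κ q m) :
    E.conf p (q ≫ e) := by
  obtain ⟨B, g, hB⟩ := E.deflation_comp h' h
  have := h.mono
  have : Mono p := ⟨fun a b hab => sq.hom_ext hab <| by
    rw [← cancel_mono m, Category.assoc, ← sq.w, Category.assoc, ← sq.w, reassoc_of% hab]⟩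
  refine hB.of_kernel p ?_ fun {T} f hf => ?_
  · rw [← Category.assoc, sq.w, Category.assoc, h.w, comp_zero]
  · obtain ⟨t, ht⟩ := h.lift (f ≫ q) (by rw [Category.assoc, hf])
    exact ⟨sq.lift f t ht.symm, sq.lift_fst _ _ _⟩

end ExactStr

/-! ### Extension orthogonality -/

section ExtOrth

variable {J₀ J₁ I₀ I₁ : A} {f : J₀ ⟶ J₁} {w : I₀ ⟶ I₁}

/-- Pulling `M` back along `f` gives an ME-conflation. In a null-homotopy of it, the summand through
`m'` dies under `e'`, so the other summand is the lift. -/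
lemma ExtOrth.exists_lift (h : ExtOrth E f w) {M R : A} {m : I₀ ⟶ M} {e : M ⟶ J₁}
    {m' : I₁ ⟶ R} {e' : R ⟶ J₁} (hM : E.conf m e) (hR : E.conf m' e') {a : M ⟶ R}
    (hm : m ≫ a = w ≫ m') (he : a ≫ e' = e) : ∃ t, t ≫ e' = f := by
  obtain ⟨P, m₀, a1, e₀, sq, hP, hm₀⟩ := hM.pullback f
  obtain ⟨s, g, hg⟩ := h _ _ (a1 ≫ a)
    ⟨m₀, e₀, m', e', hP, hR, by rw [reassoc_of% hm₀, hm], by rw [Category.assoc, he, sq.w]⟩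
    ⟨M, m, e, a1, a, hM, rfl, hm₀, sq.w.symm, hm, he.symm⟩
  have := hP.epi
  refine ⟨g, ?_⟩
  rw [← cancel_epi e₀, ← sq.w, ← he, ← Category.assoc a1, hg]
  simp [hR.w]

/-- The difference of `a1 ≫ a` and `e₀ ≫ t` vanishes under `e'`, hence factors through `m'`; on `I₀`
this factor is `w`. -/
lemma exists_extension_of_exists_lift {M R P : A} {m : I₀ ⟶ M} {e : M ⟶ J₁}
    {m' : I₁ ⟶ R} {e' : R ⟶ J₁} {m₀ : I₀ ⟶ P} {e₀ : P ⟶ J₀} (hR : E.conf m' e')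
    (hP : E.conf m₀ e₀) {a : M ⟶ R} {a1 : P ⟶ M} (hm : m ≫ a = w ≫ m') (he : a ≫ e' = e)
    (hm₀ : m₀ ≫ a1 = m) (he₀ : a1 ≫ e = e₀ ≫ f) {t : J₀ ⟶ R} (ht : t ≫ e' = f) :
    ∃ s, m₀ ≫ s = w := by
  obtain ⟨s, hs⟩ := hR.lift (a1 ≫ a - e₀ ≫ t) (by simp [he, he₀, ht])
  have := hR.mono
  refine ⟨s, ?_⟩
  rw [← cancel_mono m', Category.assoc, hs, Preadditive.comp_sub, reassoc_of% hm₀, hm,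
    reassoc_of% hP.w, zero_comp, sub_zero]

lemma ExtOrth.exists_extension (h : ExtOrth E f w) {M P : A} {m : I₀ ⟶ M} {e : M ⟶ J₁}
    {m₀ : I₀ ⟶ P} {e₀ : P ⟶ J₀} (hM : E.conf m e) (hP : E.conf m₀ e₀) {a1 : P ⟶ M}
    (hm₀ : m₀ ≫ a1 = m) (he₀ : a1 ≫ e = e₀ ≫ f) : ∃ s, m₀ ≫ s = w := by
  obtain ⟨R, m', a, e', sq, hR, he⟩ := hM.pushout w
  obtain ⟨t, ht⟩ := h.exists_lift hM hR sq.w he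
  exact exists_extension_of_exists_lift hR hP sq.w he hm₀ he₀ ht

lemma isNullHomotopic_of_exists_extension {A₀ A₁ : A} {a : A₀ ⟶ A₁} (ξ : ArrConf E w a f)
    {s : A₀ ⟶ I₁} (hs : ξ.m₀ ≫ s = w) : ξ.IsNullHomotopic := by
  obtain ⟨g, hg⟩ := ξ.conf₀.desc (a - s ≫ ξ.m₁) (by
    rw [Preadditive.comp_sub, reassoc_of% hs, ξ.comm_m, sub_self])
  exact ⟨s, g, by rw [hg]; abel⟩

/-- A single convenient `R` suffices for each `M`; this allows `R` to be built as an iterated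
pushout. -/
lemma ExtOrth.of_exists_lift
    (h : ∀ (M : A) (m : I₀ ⟶ M) (e : M ⟶ J₁), E.conf m e →
      ∃ (R : A) (m' : I₁ ⟶ R) (e' : R ⟶ J₁) (a : M ⟶ R) (t : J₀ ⟶ R),
        E.conf m' e' ∧ m ≫ a = w ≫ m' ∧ a ≫ e' = e ∧ t ≫ e' = f) : ExtOrth E f w := by
  rintro A₀ A₁ a ξ ⟨M, m, e, a1, a2, hM, -, hm₀, he₀, -, -⟩
  obtain ⟨R, m', e', b, t, hR, hm, he, ht⟩ := h M m e hM
  obtain ⟨s, hs⟩ := exists_extension_of_exists_lift hR ξ.conf₀ hm he hm₀ he₀.symm ht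
  exact isNullHomotopic_of_exists_extension ξ hs

lemma ExtOrth.of_exists_extension
    (h : ∀ (M P : A) (m : I₀ ⟶ M) (e : M ⟶ J₁) (m₀ : I₀ ⟶ P) (e₀ : P ⟶ J₀) (a1 : P ⟶ M),
      E.conf m e → E.conf m₀ e₀ → m₀ ≫ a1 = m → a1 ≫ e = e₀ ≫ f → ∃ s, m₀ ≫ s = w) :
    ExtOrth E f w := by
  rintro A₀ A₁ a ξ ⟨M, m, e, a1, a2, hM, -, hm₀, he₀, -, -⟩
  obtain ⟨s, hs⟩ := h _ _ m e _ _ a1 hM ξ.conf₀ hm₀ he₀.symm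
  exact isNullHomotopic_of_exists_extension ξ hs

lemma ExtOrth.of_exists_lift_pushout
    (h : ∀ (M R : A) (m : I₀ ⟶ M) (e : M ⟶ J₁) (m' : I₁ ⟶ R) (e' : R ⟶ J₁) (a : M ⟶ R),
      E.conf m e → E.conf m' e' → m ≫ a = w ≫ m' → a ≫ e' = e → ∃ t, t ≫ e' = f) :
    ExtOrth E f w := by
  refine .of_exists_lift fun M m e hM => ?_
  obtain ⟨R, m', a, e', sq, hR, he⟩ := hM.pushout w
  obtain ⟨t, ht⟩ := h _ _ _ _ _ _ a hM hR sq.w he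
  exact ⟨R, m', e', a, t, hR, sq.w, he, ht⟩

lemma ExtOrth.comp_right (h : ExtOrth E f w) {I₂ : A} (g : I₁ ⟶ I₂) : ExtOrth E f (w ≫ g) := by
  refine .of_exists_extension fun M P m e m₀ e₀ a1 hM hP hm he => ?_
  obtain ⟨s, hs⟩ := h.exists_extension hM hP hm he
  exact ⟨s ≫ g, by rw [reassoc_of% hs]⟩

lemma ExtOrth.precomp_left (h : ExtOrth E f w) {T : A} (g : T ⟶ J₀) : ExtOrth E (g ≫ f) w := by
  refine .of_exists_lift_pushout fun M R m e m' e' a hM hR hm he => ?_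
  obtain ⟨t, ht⟩ := h.exists_lift hM hR hm he
  exact ⟨g ≫ t, by rw [Category.assoc, ht]⟩

lemma ExtOrth.precomp_right (h : ExtOrth E f w) {T : A} (g : T ⟶ I₀) : ExtOrth E f (g ≫ w) := by
  refine .of_exists_lift_pushout fun M R m e m' e' a hM hR hm he => ?_
  obtain ⟨N, n, b, q, sq, hN, hq⟩ := hM.pushout g
  have hw : m ≫ a = g ≫ w ≫ m' := by rw [hm, Category.assoc]
  refine h.exists_lift hN hR (a := sq.desc a (w ≫ m') hw) (sq.inr_desc _ _ _) (sq.hom_ext ?_ ?_)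
  · rw [sq.inl_desc_assoc, he, hq]
  · rw [sq.inr_desc_assoc, Category.assoc, hR.w, comp_zero, hN.w]

lemma ExtOrth.comp_left (h : ExtOrth E f w) {T : A} (g : J₁ ⟶ T) : ExtOrth E (f ≫ g) w := by
  refine .of_exists_extension fun M P m e m₀ e₀ a1 hM hP hm he => ?_
  obtain ⟨N, n, b, q, sq, hN, hn⟩ := hM.pullback g
  have hw : a1 ≫ e = (e₀ ≫ f) ≫ g := by rw [he, Category.assoc]
  refine h.exists_extension hN hP (a1 := sq.lift a1 (e₀ ≫ f) hw) (sq.hom_ext ?_ ?_)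
    (sq.lift_snd _ _ _)
  · rw [Category.assoc, sq.lift_fst, hm, hn]
  · rw [Category.assoc, sq.lift_snd, reassoc_of% hP.w, zero_comp, hN.w]

variable (E) in
/-- The ideal of the morphisms `f` with `Ext (f, w) = 0`. -/
def leftOrthIdeal (w : I₀ ⟶ I₁) : MorIdeal A where
  hom X Y :=
    { carrier := {f | ExtOrth E f w}
      add_mem' := fun hf hg => .of_exists_lift_pushout fun M R m e m' e' a hM hR hm he => by
        obtain ⟨t, ht⟩ := hf.exists_lift hM hR hm he
        obtain ⟨s, hs⟩ := hg.exists_lift hM hR hm he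
        exact ⟨t + s, by rw [Preadditive.add_comp, ht, hs]⟩
      zero_mem' := .of_exists_lift_pushout fun M R m e m' e' a hM hR hm he => ⟨0, zero_comp⟩
      neg_mem' := fun hf => .of_exists_lift_pushout fun M R m e m' e' a hM hR hm he => by
        obtain ⟨t, ht⟩ := hf.exists_lift hM hR hm he
        exact ⟨-t, by rw [Preadditive.neg_comp, ht]⟩ }
  comp_mem h g f hg := (ExtOrth.comp_left hg f).precomp_left h

variable (E) in
/-- The right perpendicular of an ideal, as an ideal. -/
def rightPerpIdeal (I : MorIdeal A) : MorIdeal A where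
  hom X Y :=
    { carrier := {k | rightPerp E I k}
      add_mem' := fun hf hg _ _ i hi =>
        .of_exists_extension fun M P m e m₀ e₀ a1 hM hP hm he => by
          obtain ⟨t, ht⟩ := (hf _ _ i hi).exists_extension hM hP hm he
          obtain ⟨s, hs⟩ := (hg _ _ i hi).exists_extension hM hP hm he
          exact ⟨t + s, by rw [Preadditive.comp_add, ht, hs]⟩
      zero_mem' := fun _ _ _ _ =>
        .of_exists_extension fun M P m e m₀ e₀ a1 hM hP hm he => ⟨0, comp_zero⟩
      neg_mem' := fun hf _ _ i hi =>
        .of_exists_extension fun M P m e m₀ e₀ a1 hM hP hm he => by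
          obtain ⟨t, ht⟩ := (hf _ _ i hi).exists_extension hM hP hm he
          exact ⟨-t, by rw [Preadditive.comp_neg, ht]⟩ }
  comp_mem h _ f hg _ _ i hi := ((hg _ _ i hi).comp_right f).precomp_right h

/-! ### Generated ideals, and orthogonality to a product of ideals. -/

lemma MorIdeal.span_le {M : MorphismProperty A} {I : MorIdeal A} (h : M ≤ I.mor) :
    (MorIdeal.span M).mor ≤ I.mor := by
  intro X Y f hf
  have hf' : f ∈ (MorIdeal.span M).hom X Y := hf
  simp only [MorIdeal.span, AddSubgroup.mem_iInf] at hf'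
  exact hf' ⟨I, h⟩

lemma MorIdeal.le_span (M : MorphismProperty A) : M ≤ (MorIdeal.span M).mor := by
  intro X Y f hf
  change f ∈ (MorIdeal.span M).hom X Y
  simp only [MorIdeal.span, AddSubgroup.mem_iInf]
  exact fun I => I.2 _ hf

lemma MorIdeal.comp_mem_left {I : MorIdeal A} {X Y Z : A} (g : X ⟶ Y) {f : Y ⟶ Z} (hf : I.mor f) :
    I.mor (g ≫ f) := by
  have h := I.comp_mem g f (𝟙 Z) hf
  rwa [Category.comp_id] at h

/-- If `w = l ⋆ k` with `Ext (i, k) = 0` and `Ext (j, l) = 0` then `Ext (ij, w) = 0`. -/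
lemma ExtOrth.comp_of_isStar {V Z Y K₀ K₁ L₀ L₁ W₀ W₁ : A} {j : V ⟶ Z} {i : Z ⟶ Y}
    {l : L₀ ⟶ L₁} {w : W₀ ⟶ W₁} {k : K₀ ⟶ K₁} (hi : ExtOrth E i k) (hj : ExtOrth E j l)
    (hw : IsStar E l w k) : ExtOrth E (j ≫ i) w := by
  obtain ⟨ξ, N, n, q, a1, a2, hN, ha, hn, hq, hn', hq'⟩ := hw
  refine .of_exists_lift fun M m e hM => ?_
  obtain ⟨B, mB, b, eB, sqB, hB, hb⟩ := hM.pushout a1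
  obtain ⟨P, mP, p, eP, sqP, hP, hp⟩ := hB.pushout q
  obtain ⟨R, mR, r, eR, sqR, hR, hr⟩ := hB.pushout a2
  -- the pushout of `M` along `k` is a quotient of `P`
  obtain ⟨s, hs⟩ : ∃ s, s ≫ eP = i := by
    refine ExtOrth.exists_lift (hi.precomp_right ξ.e₀) hM hP (a := b ≫ p) ?_ ?_
    · rw [← Category.assoc, sqB.w, Category.assoc, sqP.w, ← Category.assoc, hq]
    · rw [Category.assoc, hp, hb]
  -- `B` is an extension of `P` by `L₀`. Pulled back along `s` it becomes an extension of `Z` by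
  -- `L₀`, to which `Ext (j, l) = 0` applies.
  have hBP := hN.comp_of_isPushout hB sqP
  obtain ⟨B', n', c, q', sqB', hB', hc⟩ := hBP.pullback s
  obtain ⟨Q, mQ, d, eQ, sqQ, hQ, hd⟩ := hB'.pushout l
  obtain ⟨t, ht⟩ := hj.exists_lift hB' hQ sqQ.w hd
  have hQR : n' ≫ c ≫ r = l ≫ ξ.m₁ ≫ mR := by
    rw [reassoc_of% hc, sqR.w, reassoc_of% hn']
  -- The induced map from `Q` to `R` lies over `i`, so it carries the lift `t` of `j` to a lift of
  -- `j ≫ i`.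
  have hE : sqQ.desc (c ≫ r) (ξ.m₁ ≫ mR) hQR ≫ eR = eQ ≫ i := by
    apply sqQ.hom_ext
    · rw [sqQ.inl_desc_assoc, Category.assoc, hr, reassoc_of% hd, ← hp, reassoc_of% sqB'.w, hs]
    · rw [sqQ.inr_desc_assoc, Category.assoc, hR.w, comp_zero, reassoc_of% hQ.w, zero_comp]
  refine ⟨R, mR, eR, b ≫ r, t ≫ sqQ.desc (c ≫ r) (ξ.m₁ ≫ mR) hQR, hR, ?_, ?_, ?_⟩
  · rw [← Category.assoc, sqB.w, Category.assoc, sqR.w, ← Category.assoc, ha]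
  · rw [Category.assoc, hr, hb]
  · rw [Category.assoc, hE, reassoc_of% ht]

lemma rightPerp_prod_of_isStar {I J : MorIdeal A} {K₀ K₁ L₀ L₁ W₀ W₁ : A} {l : L₀ ⟶ L₁}
    {w : W₀ ⟶ W₁} {k : K₀ ⟶ K₁} (hk : rightPerp E I k) (hl : rightPerp E J l)
    (hw : IsStar E l w k) : rightPerp E (I.prod J) w := by
  intro X Y f hf
  refine MorIdeal.span_le (I := leftOrthIdeal E w) ?_ _ hf
  rintro _ _ _ ⟨_, j, i, hj, hi, rfl⟩
  exact (hk _ _ i hi).comp_of_isStar (hl _ _ j hj) hw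

end ExtOrth

end Conflations

/-! ### The chain rule and syzygy ideals. -/

section ChainRule

variable {A : Type u} [Category.{v} A] [Preadditive A] {E : ExactStr A} {I J : MorIdeal A}

lemma IsSpecialPrecoverWith.comp {X C D : A} {i : C ⟶ X} {j : D ⟶ C} {K₀ K₁ L₀ L₁ : A}
    {k : K₀ ⟶ K₁} {l : L₀ ⟶ L₁} (hi : IsSpecialPrecoverWith E I i k)
    (hj : IsSpecialPrecoverWith E J j l) :
    ∃ (W₀ W₁ : A) (w : W₀ ⟶ W₁),
      IsSpecialPrecoverWith E (I.prod J) (j ≫ i) w ∧ IsStar E l w k := by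
  obtain ⟨hiI, hk, C₀, c, ξ, rfl⟩ := hi
  obtain ⟨hjJ, hl, D₀, d, η, rfl⟩ := hj
  -- `W₁` is the kernel of the composite precover. The upper row has middle term `D' = D₀ ×_C C₀`,
  -- and `W₀` is the kernel of `D' ⟶ C₀ ⟶ X`.
  obtain ⟨W₁, n₁, f₁, p₁, sq₁, hW₁, hn₁⟩ := η.conf₁.pullback ξ.m₁
  obtain ⟨D', nD, fD, pD, sqD, hD, hnD⟩ := η.conf₀.pullback c
  obtain ⟨W₀, n₀, f₀, p₀, sq₀, hW₀, hn₀⟩ := hD.pullback ξ.m₀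
  -- `N = D₀ ×_C K₁` mixes the upper row of `η` with the lower row of `ξ`. Thus `W₀ ⟶ N` changes
  -- only the quotient, by `k`, and `N ⟶ W₁` only the kernel, by `l`: the ME factorization.
  obtain ⟨N, n, f, p, sqN, hN, hn⟩ := η.conf₀.pullback ξ.m₁
  have hηe : η.e₀ = d ≫ η.e₁ := by rw [← η.comm_e, Category.comp_id]
  have hξe : ξ.e₀ = c ≫ ξ.e₁ := by rw [← ξ.comm_e, Category.comp_id]
  have h1 : (f₀ ≫ fD) ≫ η.e₀ = (p₀ ≫ k) ≫ ξ.m₁ := by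
    rw [Category.assoc, sqD.w, reassoc_of% sq₀.w, ξ.comm_m, Category.assoc]
  have h2 : (f ≫ d) ≫ η.e₁ = p ≫ ξ.m₁ := by rw [Category.assoc, ← hηe, sqN.w]
  have ha1 := sqN.lift_fst _ _ h1
  have ha1' := sqN.lift_snd _ _ h1
  have ha2 := sq₁.lift_fst _ _ h2
  have ha2' := sq₁.lift_snd _ _ h2
  set a1 := sqN.lift _ _ h1
  set a2 := sq₁.lift _ _ h2
  have hna1 : n₀ ≫ a1 = n := by
    apply sqN.hom_ext
    · rw [Category.assoc, ha1, reassoc_of% hn₀, hnD, hn]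
    · rw [Category.assoc, ha1', reassoc_of% hW₀.w, zero_comp, hN.w]
  have hna2 : n ≫ a2 = l ≫ n₁ := by
    apply sq₁.hom_ext
    · rw [Category.assoc, ha2, reassoc_of% hn, Category.assoc, hn₁, η.comm_m]
    · rw [Category.assoc, ha2', hN.w, Category.assoc, hW₁.w, comp_zero]
  have hstar : IsStar E l (a1 ≫ a2) k := by
    refine ⟨⟨n₀, p₀, n₁, p₁, hW₀, hW₁, ?_, ?_⟩, N, n, p, a1, a2, hN, rfl, hna1, ha1'.symm, hna2,
      ha2'.symm⟩
    · rw [reassoc_of% hna1, hna2]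
    · rw [Category.assoc, ha2', ha1']
  refine ⟨W₀, W₁, a1 ≫ a2, ⟨MorIdeal.le_span _ _ ⟨_, _, _, hjJ, hiI, rfl⟩,
    rightPerp_prod_of_isStar hk hl hstar, D', fD ≫ d,
    ⟨f₀, pD ≫ ξ.e₀, f₁, η.e₁ ≫ ξ.e₁, ξ.conf₀.comp_of_isPullback hD sq₀,
      ξ.conf₁.comp_of_isPullback η.conf₁ sq₁, ?_, ?_⟩, rfl⟩, hstar⟩
  · rw [Category.assoc, ha2, reassoc_of% ha1]
  · rw [Category.comp_id, hξe, ← reassoc_of% sqD.w, hηe]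
    simp

/-- As `I^⊥` is an ideal, an isomorphism in it forces the identity of any isomorphic object into it,
and any two kernels of `i` are isomorphic. -/
lemma isObjSpecialPrecoverWith_iff {C X K : A} {i : C ⟶ X} :
    IsObjSpecialPrecoverWith E I i K ↔
      I.mor i ∧ rightPerp E I (𝟙 K) ∧ ∃ m : K ⟶ C, E.conf m i := by
  constructor
  · rintro ⟨⟨K₀, K₁, k, _, hi, hk, C₀, c, ξ, rfl⟩, m, hm⟩
    refine ⟨hi, ?_, m, hm⟩
    obtain ⟨p, hp⟩ := hm.lift _ ξ.conf₁.w
    obtain ⟨q, hq⟩ := ξ.conf₁.lift _ hm.w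
    have h := (rightPerpIdeal E I).comp_mem (q ≫ inv k) k p hk
    have := hm.mono
    have hqp : (q ≫ inv k) ≫ k ≫ p = 𝟙 K := by
      rw [← cancel_mono m]
      simp [hp, hq]
    rwa [hqp] at h
  · rintro ⟨hi, hK, m, hm⟩
    exact ⟨⟨K, K, 𝟙 K, inferInstance, hi, hK, C, 𝟙 C, ⟨m, i, m, i, hm, hm, by simp, by simp⟩, rfl⟩,
      m, hm⟩

lemma IsObjSpecialPrecover.exists_kernel {C X : A} {i : C ⟶ X} (h : IsObjSpecialPrecover E I i) :
    ∃ K, IsObjSpecialPrecoverWith E I i K := by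
  obtain ⟨K₀, K₁, k, hk, hi, hk', C₀, c, ξ, rfl⟩ := h
  exact ⟨K₁, ⟨K₀, K₁, k, hk, hi, hk', C₀, c, ξ, rfl⟩, ξ.m₁, ξ.conf₁⟩

lemma isStar_id {X Z Y : A} (h : IsObjStar E X Z Y) : IsStar E (𝟙 X) (𝟙 Z) (𝟙 Y) := by
  obtain ⟨m, e, h⟩ := h
  exact ⟨⟨m, e, m, e, h, h, by simp, by simp⟩, Z, m, e, 𝟙 Z, 𝟙 Z, h, by simp, by simp, by simp,
    by simp, by simp⟩

lemma IsObjSpecialPrecoverWith.comp {X C D K L : A} {i : C ⟶ X} {j : D ⟶ C}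
    (hi : IsObjSpecialPrecoverWith E I i K) (hj : IsObjSpecialPrecoverWith E J j L) :
    ∃ W : A, IsObjSpecialPrecoverWith E (I.prod J) (j ≫ i) W ∧ IsObjStar E L W K := by
  rw [isObjSpecialPrecoverWith_iff] at hi hj
  obtain ⟨hi, hK, m, hm⟩ := hi
  obtain ⟨hj, hL, n, hn⟩ := hj
  obtain ⟨W, s, f, p, sq, hW, -⟩ := hn.pullback m
  have hstar : IsObjStar E L W K := ⟨s, p, hW⟩
  exact ⟨W, isObjSpecialPrecoverWith_iff.2 ⟨MorIdeal.le_span _ _ ⟨_, _, _, hj, hi, rfl⟩,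
    rightPerp_prod_of_isStar hK hL (isStar_id hstar), f, hm.comp_of_isPullback hn sq⟩, hstar⟩

/-- If a syzygy factors through an object `U` with `𝟙 U ∈ I^⊥`, then `U` is an object syzygy. -/
lemma IsSpecialPrecoverWith.exists_obj_of_factor {X C K₀ K₁ U : A} {i : C ⟶ X} {a : K₀ ⟶ U}
    {b : U ⟶ K₁} (h : IsSpecialPrecoverWith E I i (a ≫ b)) (hU : rightPerp E I (𝟙 U)) :
    ∃ (C' : A) (i' : C' ⟶ X), IsObjSpecialPrecoverWith E I i' U := by
  obtain ⟨hi, -, C₀, c, ξ, rfl⟩ := h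
  -- Pushing the upper row out along `a` only gives kernel `U`, and the new deflation still factors
  -- through `ξ.e₁`, hence lies in `I`.
  obtain ⟨C', m', f', e', sq, hC', he'⟩ := ξ.conf₀.pushout a
  refine ⟨C', e', isObjSpecialPrecoverWith_iff.2 ⟨?_, hU, m', hC'⟩⟩
  have hc : ξ.m₀ ≫ c = a ≫ b ≫ ξ.m₁ := by rw [ξ.comm_m, Category.assoc]
  have : sq.desc c (b ≫ ξ.m₁) hc ≫ ξ.e₁ = e' := by
    apply sq.hom_ext
    · rw [sq.inl_desc_assoc, he', ← ξ.comm_e, Category.comp_id]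
    · rw [sq.inr_desc_assoc, Category.assoc, ξ.conf₁.w, comp_zero, hC'.w]
  rw [← this]
  exact MorIdeal.comp_mem_left _ hi

lemma isSyzygyIdeal_diamond {wI wJ : MorIdeal A} (hI : IsSyzygyIdeal E I wI)
    (hJ : IsSyzygyIdeal E J wJ) : IsSyzygyIdeal E (I.prod J) (diamond E wJ wI) := by
  refine ⟨MorIdeal.span_le (I := rightPerpIdeal E (I.prod J)) ?_, fun X => ?_⟩
  · rintro _ _ w ⟨_, _, _, _, l, k, hl, hk, hw⟩
    exact rightPerp_prod_of_isStar (hI.1 _ hk) (hJ.1 _ hl) hw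
  · obtain ⟨C, i, K₀, K₁, k, hi, hk⟩ := hI.2 X
    obtain ⟨D, j, L₀, L₁, l, hj, hl⟩ := hJ.2 C
    obtain ⟨W₀, W₁, w, h, hw⟩ := hi.comp hj
    exact ⟨D, j ≫ i, W₀, W₁, w, h, MorIdeal.le_span _ _ ⟨_, _, _, _, l, k, hl, hk, hw⟩⟩

lemma objIdeal_le_iff {P : ObjectProperty A} {W : MorIdeal A} :
    (objIdeal P).mor ≤ W.mor ↔ ∀ X, P X → W.mor (𝟙 X) := by
  constructor
  · intro h X hX
    exact h _ (MorIdeal.le_span _ _ ⟨hX, rfl, rfl⟩)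
  · intro h
    refine MorIdeal.span_le ?_
    rintro X _ f ⟨hX, rfl, rfl⟩
    exact h X hX

lemma isObjStar_of_isZero {X Y Z : A} (hX : IsZero X) (hY : IsZero Y) (hZ : IsZero Z) :
    IsObjStar E X Z Y := by
  obtain ⟨T, e, h⟩ := E.id_inflation X
  have := h.epi
  have he : e = 0 := hX.eq_of_src _ _
  have hT : IsZero T := by
    rw [IsZero.iff_id_eq_zero, ← cancel_epi e, he]
    simp
  exact ⟨0, 0, E.of_iso (Iso.refl _) (hX.iso hZ) (hT.iso hY) (hX.eq_of_src _ _)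
    (hX.eq_of_src _ _) h⟩

end ChainRule

/-! ### Direct sums and syzygy subcategories. -/

section FiniteProducts

variable {A : Type u} [Category.{v} A] [Preadditive A] [HasFiniteBiproducts A]

attribute [local instance] hasBinaryBiproducts_of_finite_biproducts

/-- The ideal of the morphisms that factor through an object of `P`. -/
def factorIdeal (P : ObjectProperty A) [P.IsClosedUnderFiniteProducts] : MorIdeal A where
  hom X Y :=
    { carrier := {f | ∃ (U : A) (a : X ⟶ U) (b : U ⟶ Y), P U ∧ a ≫ b = f}
      add_mem' := by
        rintro _ _ ⟨U, a, b, hU, rfl⟩ ⟨V, c, d, hV, rfl⟩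
        exact ⟨U ⊞ V, biprod.lift a c, biprod.desc b d,
          P.prop_of_isLimit_binaryFan (BinaryBiproduct.isLimit U V) hU hV, by simp⟩
      zero_mem' := ⟨⊤_ A, 0, 0, P.prop_terminal, by simp⟩
      neg_mem' := by
        rintro _ ⟨U, a, b, hU, rfl⟩
        exact ⟨U, -a, b, hU, by simp⟩ }
  comp_mem := by
    rintro _ _ _ _ h _ f ⟨U, a, b, hU, rfl⟩
    exact ⟨U, h ≫ a, b ≫ f, hU, by simp⟩

lemma exists_factor_of_mem_objIdeal {P : ObjectProperty A} [P.IsClosedUnderFiniteProducts]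
    {X Y : A} {f : X ⟶ Y} (hf : (objIdeal P).mor f) :
    ∃ (U : A) (a : X ⟶ U) (b : U ⟶ Y), P U ∧ a ≫ b = f :=
  objIdeal_le_iff (W := factorIdeal P).2 (fun X hX => ⟨X, 𝟙 X, 𝟙 X, hX, by simp⟩) _ hf

variable {E : ExactStr A} {I J : MorIdeal A}

namespace ExactStr

variable {X Y Z : A} {m : X ⟶ Y} {e : Y ⟶ Z}

lemma conf.biprod_map_id (h : E.conf m e) (X' : A) :
    E.conf (biprod.map m (𝟙 X')) (biprod.fst ≫ e) := by
  refine h.of_isPushout (f := biprod.inl) (f' := biprod.inl)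
    ⟨⟨by simp⟩, ⟨PushoutCocone.IsColimit.mk _
      (fun s => biprod.desc s.inl (biprod.inr ≫ s.inr)) (fun s => by simp) (fun s => ?_)
      fun s t h₁ h₂ => ?_⟩⟩ (by simp) ?_
  · have := s.condition
    ext <;> simp [this]
  · ext
    · simpa using h₁
    · simp [← h₂]
  · simp [h.w]

lemma conf.biprod_id_map (h : E.conf m e) (X' : A) :
    E.conf (biprod.map (𝟙 X') m) (biprod.snd ≫ e) :=
  E.of_iso (biprod.braiding _ _) (biprod.braiding _ _) (Iso.refl _) (by ext <;> simp) (by simp)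
    (h.biprod_map_id X')

/-- The direct sum of two conflations is a conflation. -/
lemma conf.biprod_map (h : E.conf m e) {X' Y' Z' : A} {m' : X' ⟶ Y'} {e' : Y' ⟶ Z'}
    (h' : E.conf m' e') : E.conf (biprod.map m m') (biprod.map e e') := by
  -- `m ⊕ m'` is the composite of the inflations `m ⊕ 1` and `1 ⊕ m'`.
  obtain ⟨B, g, hB⟩ := E.inflation_comp (h.biprod_map_id X') (h'.biprod_id_map Y)
  have hmm : biprod.map m (𝟙 X') ≫ biprod.map (𝟙 Y) m' = biprod.map m m' := by ext <;> simp
  rw [hmm] at hB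
  have := h.epi
  have := h'.epi
  refine hB.of_cokernel _ (by ext <;> simp [h.w, h'.w]) fun {T} f hf => ?_
  obtain ⟨s, hs⟩ := h.desc (biprod.inl ≫ f) (by simpa using biprod.inl ≫= hf)
  obtain ⟨t, ht⟩ := h'.desc (biprod.inr ≫ f) (by simpa using biprod.inr ≫= hf)
  exact ⟨biprod.desc s t, by ext <;> simp [hs, ht]⟩

end ExactStr

lemma isClosedUnderFiniteProducts_starObj (P Q : ObjectProperty A)
    [P.IsClosedUnderFiniteProducts] [Q.IsClosedUnderFiniteProducts] :
    (starObj E P Q).IsClosedUnderFiniteProducts := by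
  have hiso : (starObj E P Q).IsClosedUnderIsomorphisms := ⟨by
    rintro Z Z' φ ⟨X, Y, hX, hY, m, e, h⟩
    exact ⟨X, Y, hX, hY, m ≫ φ.hom, φ.inv ≫ e,
      E.of_iso (Iso.refl _) φ (Iso.refl _) (by simp) (by simp) h⟩⟩
  have hzero : (starObj E P Q).IsClosedUnderLimitsOfShape (Discrete.{0} PEmpty) := by
    have hT : IsZero (⊤_ A) := (isZero_zero A).of_iso (terminalIsTerminal.uniqueUpToIso
      (isZero_zero A).isTerminal)
    have : (starObj E P Q).ContainsZero :=
      ⟨⟨⊤_ A, hT, ⊤_ A, ⊤_ A, P.prop_terminal, Q.prop_terminal, isObjStar_of_isZero hT hT hT⟩⟩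
    infer_instance
  have hprod : (starObj E P Q).IsClosedUnderBinaryProducts := .mk' (by
    rintro _ ⟨F, hF⟩
    obtain ⟨X, Y, hX, hY, m, e, h⟩ := hF ⟨.left⟩
    obtain ⟨X', Y', hX', hY', m', e', h'⟩ := hF ⟨.right⟩
    have hZ : starObj E P Q (F.obj ⟨.left⟩ ⊞ F.obj ⟨.right⟩) :=
      ⟨X ⊞ X', Y ⊞ Y', P.prop_of_isLimit_binaryFan (BinaryBiproduct.isLimit _ _) hX hX',
        Q.prop_of_isLimit_binaryFan (BinaryBiproduct.isLimit _ _) hY hY', _, _, h.biprod_map h'⟩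
    exact (starObj E P Q).prop_of_iso (biprod.isoProd _ _ ≪≫ (HasLimit.isoOfNatIso
      (diagramIsoPair F)).symm) hZ)
  exact .mk'

/-- Closure under direct sums makes every syzygy in `objIdeal P` factor through one object of `P`,
which then serves as an object syzygy. -/
lemma IsSyzygySubcat.exists_objSpecialPrecover {P : ObjectProperty A} (hP : IsSyzygySubcat E I P)
    (X : A) : ∃ (C : A) (i : C ⟶ X) (U : A), P U ∧ IsObjSpecialPrecoverWith E I i U := by
  have := hP.1
  obtain ⟨C, i, K₀, K₁, k, hi, hk⟩ := hP.2.2 X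
  obtain ⟨U, a, b, hU, rfl⟩ := exists_factor_of_mem_objIdeal hk
  have hU' := objIdeal_le_iff (W := rightPerpIdeal E I).1 hP.2.1 U hU
  obtain ⟨C', i', h⟩ := hi.exists_obj_of_factor hU'
  exact ⟨C', i', U, hU, h⟩

lemma isSyzygySubcat_starObj {P Q : ObjectProperty A} (hP : IsSyzygySubcat E I P)
    (hQ : IsSyzygySubcat E J Q) : IsSyzygySubcat E (I.prod J) (starObj E Q P) := by
  have := hP.1
  have := hQ.1
  refine ⟨isClosedUnderFiniteProducts_starObj Q P,
    objIdeal_le_iff (W := rightPerpIdeal E (I.prod J)).2 ?_, fun X => ?_⟩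
  · rintro Z ⟨V, U, hV, hU, hZ⟩
    exact rightPerp_prod_of_isStar (objIdeal_le_iff (W := rightPerpIdeal E I).1 hP.2.1 U hU)
      (objIdeal_le_iff (W := rightPerpIdeal E J).1 hQ.2.1 V hV) (isStar_id hZ)
  · obtain ⟨C, i, U, hU, hi⟩ := hP.exists_objSpecialPrecover X
    obtain ⟨D, j, V, hV, hj⟩ := hQ.exists_objSpecialPrecover C
    obtain ⟨W, hW, hW'⟩ := hi.comp hj
    obtain ⟨hji, hW, m, hm⟩ := isObjSpecialPrecoverWith_iff.1 hW
    exact ⟨D, j ≫ i, W, W, 𝟙 W,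
      ⟨hji, hW, D, 𝟙 D, ⟨m, j ≫ i, m, j ≫ i, hm, hm, by simp, by simp⟩, rfl⟩,
      MorIdeal.le_span _ _ ⟨⟨V, U, hV, hU, hW'⟩, rfl, rfl⟩⟩

end FiniteProducts

end IdealApprox

open IdealApprox in
theorem mainTheorem9 {A : Type u} [Category.{v} A] [Preadditive A] [HasFiniteBiproducts A]
    (E : ExactStr A) (I J : MorIdeal A) :
    -- chain rule for syzygies
    (∀ {X C D : A} (i : C ⟶ X) (j : D ⟶ C) {K₀ K₁ L₀ L₁ : A} (k : K₀ ⟶ K₁) (l : L₀ ⟶ L₁),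
      IsSpecialPrecoverWith E I i k → IsSpecialPrecoverWith E J j l →
        ∃ (W₀ W₁ : A) (w : W₀ ⟶ W₁),
          IsSpecialPrecoverWith E (I.prod J) (j ≫ i) w ∧ IsStar E l w k) ∧
    -- chain rule for object syzygies
    (∀ {X C D : A} (i : C ⟶ X) (j : D ⟶ C) (K L : A),
      IsObjSpecialPrecoverWith E I i K → IsObjSpecialPrecoverWith E J j L →
        ∃ W : A, IsObjSpecialPrecoverWith E (I.prod J) (j ≫ i) W ∧ IsObjStar E L W K) ∧
    -- products of special precovering ideals
    (IsSpecialPrecovering E I → IsSpecialPrecovering E J →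
      IsSpecialPrecovering E (I.prod J) ∧
      ∀ wI wJ : MorIdeal A, IsSyzygyIdeal E I wI → IsSyzygyIdeal E J wJ →
        IsSyzygyIdeal E (I.prod J) (diamond E wJ wI)) ∧
    -- products of object-special precovering ideals
    (IsObjSpecialPrecovering E I → IsObjSpecialPrecovering E J →
      IsObjSpecialPrecovering E (I.prod J) ∧
      ∀ ΩI ΩJ : ObjectProperty A, IsSyzygySubcat E I ΩI → IsSyzygySubcat E J ΩJ →
        IsSyzygySubcat E (I.prod J) (starObj E ΩJ ΩI)) := by
  refine ⟨fun i j _ _ _ _ k l hi hj => hi.comp hj, fun i j K L hi hj => hi.comp hj,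
    fun hI hJ => ⟨fun X => ?_, fun wI wJ => isSyzygyIdeal_diamond⟩,
    fun hI hJ => ⟨fun X => ?_, fun ΩI ΩJ => isSyzygySubcat_starObj⟩⟩
  · obtain ⟨C, i, K₀, K₁, k, hi⟩ := hI X
    obtain ⟨D, j, L₀, L₁, l, hj⟩ := hJ C
    obtain ⟨W₀, W₁, w, h, -⟩ := hi.comp hj
    exact ⟨D, j ≫ i, W₀, W₁, w, h⟩
  · obtain ⟨C, i, hi⟩ := hI X
    obtain ⟨D, j, hj⟩ := hJ C
    obtain ⟨K, hi⟩ := hi.exists_kernel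
    obtain ⟨L, hj⟩ := hj.exists_kernel
    obtain ⟨W, h, -⟩ := hi.comp hj
    exact ⟨D, j ≫ i, h.1⟩
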